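/- **Budget-limited bandit.** An instance with $K$ arms consists of pulling costs $c_1,\dots,c_K\ge 1$ and reward distributions $\nu_1,\dots,\nu_K$ supported in $[0,1]$. Pulling arm $i$ costs $c_i$ and yields a reward drawn from $\nu_i$ independently of the past. An arm-pulling algorithm $A$ chooses in each round, possibly at random, either an arm to pull or to stop for good. It may use the costs, the budget $B$ and all past pulls and rewards, but not the distributions $\nu_i$. On every instance and for every budget $B>0$, its total cost must be at most $B$ almost surely. Let $G_B(A)$ be the total reward of $A$. The regret of $A$ on an instance $I$ is $R_B(A,I)=\sup_{A'}\mathbf E[G_B(A')]-\mathbf E[G_B(A)]$, where the supremum is over all such algorithms $A'$ (since $I$ is fixed, algorithms tuned to the reward distributions of $I$ are included). Call $A$ *consistent* if $R_B(A,I)=o(B^a)$ as $B\to\infty$ for every $a>0$ and every instance $I$ with $K$ arms. **Theorem.** Let $K\ge 2$ and let $A$ be any arm-pulling algorithm for $K$ arms. 1. There are a constant $C>0$ and an instance $I$ (not depending on $B$) such that $R_B(A,I)\ge C\ln B$ for arbitrarily large budgets $B$. 2. If $A$ is consistent, then there are a constant $C>0$ and an instance $I$ (not depending on $B$) such that $R_B(A,I)\ge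 C\ln B$ for all sufficiently large $B$. -/

import Mathlib

open MeasureTheory ProbabilityTheory Filter Asymptotics

noncomputable section

namespace BudgetMAB

/-- What an algorithm does in one round: pull an arm, or stop (`Sum.inr ()`). -/
abbrev Action (K : ℕ) : Type := Fin K ⊕ Unit

/-- What happens in one round: an arm is pulled and yields a reward, or nothing happens because the
algorithm has stopped (`Sum.inr ()`). -/
abbrev Outcome (K : ℕ) : Type := (Fin K × ℝ) ⊕ Unit

/-- The record of the first `n` rounds. -/
abbrev History (K n : ℕ) : Type := Fin n → Outcome K

/-- A budget-limited bandit with `K` arms: pulling costs at least `1` and reward distributions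
supported in `[0, 1]`. -/
structure Instance (K : ℕ) where
  cost : Fin K → ℝ
  one_le_cost : ∀ i, 1 ≤ cost i
  reward : Fin K → Measure ℝ
  isProbabilityMeasure_reward : ∀ i, IsProbabilityMeasure (reward i)
  reward_mem : ∀ i, ∀ᵐ x ∂reward i, x ∈ Set.Icc (0 : ℝ) 1

/-- The response of the machine to an action: pulling arm `i` yields a reward drawn from the
distribution of arm `i`. -/
def Instance.respond {K : ℕ} (I : Instance K) : Kernel (Action K) (Outcome K) where
  toFun := Sum.elim (fun i => (I.reward i).map fun x => (Sum.inl (i, x) : Outcome K))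
    (fun _ => Measure.dirac (Sum.inr () : Outcome K))
  measurable' := Measurable.sumElim (measurable_of_countable _) (measurable_of_countable _)

/-- Number of pulls of arm `i` in a history. -/
def numPulls {K n : ℕ} (i : Fin K) (h : History K n) : ℕ :=
  ∑ t, Sum.elim (fun p : Fin K × ℝ => if p.1 = i then 1 else 0) (fun _ => 0) (h t)

/-- Total cost of a history. -/
def totalCost {K n : ℕ} (c : Fin K → ℝ) (h : History K n) : ℝ :=
  ∑ i, (numPulls i h : ℝ) * c i

/-- Total reward collected in a history. -/
def totalReward {K n : ℕ} (h : History K n) : ℝ :=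
  ∑ t, Sum.elim (fun p : Fin K × ℝ => p.2) (fun _ => 0) (h t)

/-- A (possibly randomised) rule for choosing the next action. It may use the costs `c`, the
budget `B` and everything observed so far, but not the reward distributions. Stopping is final. -/
structure Policy (K : ℕ) where
  next : (Fin K → ℝ) → ℝ → (n : ℕ) → Kernel (History K n) (Action K)
  isMarkovKernel_next : ∀ c B n, IsMarkovKernel (next c B n)
  stop_final : ∀ c B n (h : History K n), (∃ t, h t = Sum.inr ()) →
    next c B n h = Measure.dirac (Sum.inr ())

/-- The law of the first `n` rounds when the policy `A` with budget `B` runs on the instance `I`. -/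
def Policy.law {K : ℕ} (A : Policy K) (I : Instance K) (B : ℝ) : (n : ℕ) → Measure (History K n)
  | 0 => Measure.dirac Fin.elim0
  | n + 1 => (A.law I B n ⊗ₘ (I.respond ∘ₖ A.next I.cost B n)).map
      fun p => (Fin.snoc p.1 p.2 : History K (n + 1))

/-- An arm-pulling algorithm: a policy whose total cost almost surely never exceeds the budget,
whatever the instance. -/
structure Algorithm (K : ℕ) extends Policy K where
  within_budget : ∀ (I : Instance K) (B : ℝ), 0 < B → ∀ n,
    ∀ᵐ h ∂(toPolicy.law I B n), totalCost I.cost h ≤ B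

/-- The expected total reward `E[G(A)]`. As every pull costs at least `1`, all pulls take place in
the first `⌊B⌋` rounds. -/
def Algorithm.expectedReward {K : ℕ} (A : Algorithm K) (I : Instance K) (B : ℝ) : ℝ :=
  ∫ h, totalReward h ∂(A.law I B ⌊B⌋₊)

/-- The largest expected total reward that any algorithm achieves on `I` with budget `B`. An
algorithm tuned to the reward distributions of this `I` is admitted here. -/
def Instance.optimalReward {K : ℕ} (I : Instance K) (B : ℝ) : ℝ :=
  ⨆ A : Algorithm K, A.expectedReward I B

/-- The regret of `A` on `I` with budget `B`. -/
def Algorithm.regret {K : ℕ} (A : Algorithm K) (I : Instance K) (B : ℝ) : ℝ :=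
  I.optimalReward B - A.expectedReward I B

/-- The algorithm has subpolynomial regret on every instance ("uniformly good" in the sense of Lai
and Robbins). -/
def Algorithm.IsConsistent {K : ℕ} (A : Algorithm K) : Prop :=
  ∀ (I : Instance K) (a : ℝ), 0 < a → (fun B : ℝ => A.regret I B) =o[atTop] fun B : ℝ => B ^ a

end BudgetMAB

end

noncomputable section

namespace BudgetMAB

open scoped ENNReal

attribute [local instance] Instance.isProbabilityMeasure_reward Policy.isMarkovKernel_next

variable {K : ℕ}

/-! No algorithm does well on two instances that look alike to it. With unit costs the budget is a
horizon of `⌊B⌋₊` rounds. In the reference instance arm `i₀` is Bernoulli with mean 1/2 and all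
other arms have mean 1/4; in the alternative one arm `j ≠ i₀` is raised to 3/4. Each pull of `j`
multiplies the likelihood by at least 1/3, so an event with at most `m` pulls of `j` keeps at least
a fraction `3⁻ᵐ` of its probability in the alternative (`lintegral_pow_numPulls_mul_le`).

Take `m` about `log B / (2 log 3)`, so that `3ᵐ ≤ √B`. If at most `m` pulls of `j` had probability
above 1/2 on the reference instance, the regret on the alternative would be of order `√B`, against
consistency. Hence `j` is pulled more than `m` times with probability at least 1/2, and each such
pull loses 1/4 (`exists_regret_tradeoff`). An inconsistent algorithm has regret above `c * B ^ a`
for arbitrarily large `B`, which beats the logarithm; the first claim follows by cases. -/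

/-! ### Integration over histories, round by round -/

lemma measurable_inl_prodMk (i : Fin K) :
    Measurable fun x : ℝ => (Sum.inl (i, x) : Outcome K) := by fun_prop

instance (I : Instance K) : IsMarkovKernel I.respond where
  isProbabilityMeasure a := by
    rcases a with i | u
    · exact Measure.isProbabilityMeasure_map (measurable_inl_prodMk i).aemeasurable
    · exact Measure.dirac.isProbabilityMeasure

lemma lintegral_respond_inl (I : Instance K) (i : Fin K) {f : Outcome K → ℝ≥0∞}
    (hf : Measurable f) :
    ∫⁻ o, f o ∂I.respond (Sum.inl i) = ∫⁻ x, f (Sum.inl (i, x)) ∂I.reward i :=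
  lintegral_map hf (measurable_inl_prodMk i)

lemma lintegral_respond_inr (I : Instance K) (u : Unit) {f : Outcome K → ℝ≥0∞}
    (hf : Measurable f) :
    ∫⁻ o, f o ∂I.respond (Sum.inr u) = f (Sum.inr ()) :=
  lintegral_dirac' _ hf

lemma measurable_snoc (n : ℕ) :
    Measurable fun p : History K n × Outcome K => (Fin.snoc p.1 p.2 : History K (n + 1)) := by
  refine measurable_pi_iff.2 fun t => ?_
  refine Fin.lastCases ?_ (fun t => ?_) t
  · simpa using measurable_snd
  · simpa using measurable_fst.eval (a := t)

instance (A : Policy K) (I : Instance K) (B : ℝ) (n : ℕ) :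
    IsProbabilityMeasure (A.law I B n) := by
  induction n with
  | zero => exact Measure.dirac.isProbabilityMeasure
  | succ n ih => exact Measure.isProbabilityMeasure_map (measurable_snoc n).aemeasurable

/-- Integration over `n + 1` rounds, conditioning on the first `n`. -/
lemma lintegral_law_succ (A : Policy K) (I : Instance K) (B : ℝ) (n : ℕ)
    {f : History K (n + 1) → ℝ≥0∞} (hf : Measurable f) :
    ∫⁻ h, f h ∂A.law I B (n + 1) =
      ∫⁻ h, ∫⁻ a, ∫⁻ o, f (Fin.snoc h o) ∂I.respond a ∂A.next I.cost B n h ∂A.law I B n := by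
  have hm : Measurable fun p : History K n × Outcome K => f (Fin.snoc p.1 p.2) :=
    hf.comp (measurable_snoc n)
  rw [Policy.law, lintegral_map hf (measurable_snoc n), Measure.lintegral_compProd hm]
  refine lintegral_congr fun h => ?_
  exact Kernel.lintegral_comp _ _ _ (hm.comp measurable_prodMk_left)

lemma measurable_lintegral_snoc (A : Policy K) (I : Instance K) (B : ℝ) (n : ℕ)
    {f : History K (n + 1) → ℝ≥0∞} (hf : Measurable f) :
    Measurable fun h =>
      ∫⁻ a, ∫⁻ o, f (Fin.snoc h o) ∂I.respond a ∂A.next I.cost B n h := by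
  have hm : Measurable fun p : History K n × Outcome K => f (Fin.snoc p.1 p.2) :=
    hf.comp (measurable_snoc n)
  have := hm.lintegral_kernel_prod_right' (κ := I.respond ∘ₖ A.next I.cost B n)
  convert this using 2 with h
  exact (Kernel.lintegral_comp _ _ _ (hm.comp measurable_prodMk_left)).symm

lemma ae_law_succ (A : Policy K) (I : Instance K) (B : ℝ) (n : ℕ)
    {s : Set (History K (n + 1))} (hs : MeasurableSet s)
    (h : ∀ᵐ h ∂A.law I B n, ∀ᵐ a ∂A.next I.cost B n h, ∀ᵐ o ∂I.respond a,
      (Fin.snoc h o : History K (n + 1)) ∈ s) :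
    ∀ᵐ h ∂A.law I B (n + 1), h ∈ s := by
  change A.law I B (n + 1) sᶜ = 0
  rw [← lintegral_indicator_one hs.compl,
    lintegral_law_succ _ _ _ _ (measurable_one.indicator hs.compl)]
  refine lintegral_eq_zero_of_ae_eq_zero (h.mono fun h hh => ?_)
  refine lintegral_eq_zero_of_ae_eq_zero (hh.mono fun a ha => ?_)
  refine lintegral_eq_zero_of_ae_eq_zero (ha.mono fun o ho => ?_)
  simp [ho]

lemma measurable_sum_apply {n : ℕ} {M : Type*} [AddCommMonoid M] [MeasurableSpace M]
    [MeasurableAdd₂ M] {g : Outcome K → M} (hg : Measurable g) :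
    Measurable fun h : History K n => ∑ t, g (h t) :=
  Finset.measurable_fun_sum _ fun t _ => hg.comp (measurable_pi_apply t)

/-- If one additive functional is dominated by another in conditional expectation in every round,
then it is dominated in expectation. -/
lemma lintegral_sum_le_of_respond (A : Policy K) (I : Instance K) (B : ℝ) (n : ℕ)
    {f g : Outcome K → ℝ≥0∞} (hf : Measurable f) (hg : Measurable g)
    (h : ∀ a, ∫⁻ o, f o ∂I.respond a ≤ ∫⁻ o, g o ∂I.respond a) :
    ∫⁻ h, ∑ t, f (h t) ∂A.law I B n ≤ ∫⁻ h, ∑ t, g (h t) ∂A.law I B n := by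
  induction n with
  | zero => simp
  | succ n ih =>
    -- The expectation splits into the first `n` rounds and the conditional mean of the last one.
    have key : ∀ {f : Outcome K → ℝ≥0∞}, Measurable f →
        ∫⁻ h, ∑ t, f (h t) ∂A.law I B (n + 1) = ∫⁻ h, ∑ t, f (h t) ∂A.law I B n +
          ∫⁻ h, ∫⁻ a, ∫⁻ o, f o ∂I.respond a ∂A.next I.cost B n h ∂A.law I B n := by
      intro f hf
      rw [lintegral_law_succ _ _ _ _ (measurable_sum_apply hf),
        ← lintegral_add_left (measurable_sum_apply hf)]
      refine lintegral_congr fun h => ?_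
      simp_rw [Fin.sum_univ_castSucc, Fin.snoc_castSucc, Fin.snoc_last,
        lintegral_add_left measurable_const]
      simp [lintegral_add_left measurable_const]
    rw [key hf, key hg]
    exact add_le_add ih (lintegral_mono fun _ => lintegral_mono h)

/-- The expected number of rounds with outcome outside `s` is dominated by 0. -/
lemma ae_law_apply (A : Policy K) (I : Instance K) (B : ℝ) (n : ℕ)
    {s : Set (Outcome K)} (hs : MeasurableSet s) (h : ∀ a, ∀ᵐ o ∂I.respond a, o ∈ s) :
    ∀ᵐ h ∂A.law I B n, ∀ t, h t ∈ s := by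
  have hm : Measurable (sᶜ.indicator (1 : Outcome K → ℝ≥0∞)) :=
    measurable_one.indicator hs.compl
  have h0 := lintegral_sum_le_of_respond A I B n hm (measurable_const (a := (0 : ℝ≥0∞))) fun a => by
    rw [lintegral_indicator_one hs.compl, show I.respond a sᶜ = 0 from h a]
    simp
  simp only [Finset.sum_const_zero, lintegral_zero, nonpos_iff_eq_zero] at h0
  rw [lintegral_eq_zero_iff (measurable_sum_apply hm)] at h0
  filter_upwards [h0] with h hh t
  simp only [Pi.zero_apply, Finset.sum_eq_zero_iff, Finset.mem_univ, true_imp_iff] at hh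
  by_contra ht
  simpa [ht] using hh t

/-! ### Rewards, pulls and costs -/

/-- The reward of one round. -/
def outcomeReward : Outcome K → ℝ := Sum.elim (fun p => p.2) fun _ => 0

/-- Number of pulls of arm `i` in one round. -/
def outcomePulls (i : Fin K) : Outcome K → ℕ :=
  Sum.elim (fun p => if p.1 = i then 1 else 0) fun _ => 0

lemma measurable_outcomeReward : Measurable (outcomeReward (K := K)) :=
  measurable_snd.sumElim measurable_const

lemma measurable_outcomePulls (i : Fin K) : Measurable (outcomePulls i) :=
  Measurable.sumElim
    (Measurable.ite (measurable_fst (measurableSet_singleton i)) measurable_const measurable_const)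
    measurable_const

lemma numPulls_eq {n : ℕ} (i : Fin K) (h : History K n) :
    numPulls i h = ∑ t, outcomePulls i (h t) := rfl

lemma totalReward_eq {n : ℕ} (h : History K n) :
    totalReward h = ∑ t, outcomeReward (h t) := rfl

lemma measurable_numPulls {n : ℕ} (i : Fin K) : Measurable (numPulls (n := n) i) :=
  measurable_sum_apply (measurable_outcomePulls i)

lemma measurable_totalReward {n : ℕ} : Measurable (totalReward (K := K) (n := n)) :=
  measurable_sum_apply measurable_outcomeReward

lemma measurable_totalCost {n : ℕ} (c : Fin K → ℝ) : Measurable (totalCost (n := n) c) :=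
  Finset.measurable_fun_sum _ fun i _ =>
    ((measurable_of_countable (Nat.cast : ℕ → ℝ)).comp (measurable_numPulls i)).mul_const _

lemma numPulls_snoc {n : ℕ} (i : Fin K) (h : History K n) (o : Outcome K) :
    numPulls i (Fin.snoc h o : History K (n + 1)) = numPulls i h + outcomePulls i o := by
  simp [numPulls_eq, Fin.sum_univ_castSucc]

lemma totalCost_snoc_inl {n : ℕ} (c : Fin K → ℝ) (h : History K n) (i : Fin K) (x : ℝ) :
    totalCost c (Fin.snoc h (Sum.inl (i, x)) : History K (n + 1)) = totalCost c h + c i := by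
  simp [totalCost, numPulls_snoc, outcomePulls, add_mul, Finset.sum_add_distrib]

lemma totalCost_snoc_inr {n : ℕ} (c : Fin K → ℝ) (h : History K n) (u : Unit) :
    totalCost c (Fin.snoc h (Sum.inr u) : History K (n + 1)) = totalCost c h := by
  simp [totalCost, numPulls_snoc, outcomePulls]

lemma ae_respond_inl (I : Instance K) (i : Fin K) {s : Set (Outcome K)} (hs : MeasurableSet s)
    (h : ∀ᵐ x ∂I.reward i, Sum.inl (i, x) ∈ s) : ∀ᵐ o ∂I.respond (Sum.inl i), o ∈ s :=
  (ae_map_iff (measurable_inl_prodMk i).aemeasurable hs).2 h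

lemma ae_respond_inr (I : Instance K) (u : Unit) {s : Set (Outcome K)} (hs : MeasurableSet s)
    (h : Sum.inr () ∈ s) : ∀ᵐ o ∂I.respond (Sum.inr u), o ∈ s :=
  (ae_dirac_iff hs).2 h

lemma ae_outcomeReward_mem (A : Policy K) (I : Instance K) (B : ℝ) (n : ℕ) :
    ∀ᵐ h ∂A.law I B n, ∀ t, outcomeReward (h t) ∈ Set.Icc (0 : ℝ) 1 := by
  have hs : MeasurableSet (outcomeReward (K := K) ⁻¹' Set.Icc (0 : ℝ) 1) :=
    measurable_outcomeReward measurableSet_Icc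
  refine ae_law_apply A I B n hs fun a => ?_
  rcases a with i | u
  · exact ae_respond_inl I i hs (I.reward_mem i)
  · exact ae_respond_inr I u hs (by simp [outcomeReward])

/-- Rewards are nonnegative and bounded, so expected rewards can be compared as lower integrals of
additive functionals, where no integrability is needed. -/
lemma ofReal_expectedReward (A : Algorithm K) (I : Instance K) (B : ℝ) :
    ENNReal.ofReal (A.expectedReward I B) =
      ∫⁻ h, ∑ t, ENNReal.ofReal (outcomeReward (h t)) ∂A.law I B ⌊B⌋₊ := by
  have hmem := ae_outcomeReward_mem A.toPolicy I B ⌊B⌋₊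
  have hint : Integrable (fun h => totalReward h) (A.law I B ⌊B⌋₊) := by
    refine Integrable.of_bound measurable_totalReward.aestronglyMeasurable (⌊B⌋₊ : ℝ) ?_
    filter_upwards [hmem] with h hh
    rw [totalReward_eq, Real.norm_eq_abs, abs_of_nonneg (Finset.sum_nonneg fun t _ => (hh t).1)]
    simpa using Finset.sum_le_sum fun t (_ : t ∈ Finset.univ) => (hh t).2
  rw [Algorithm.expectedReward, ofReal_integral_eq_lintegral_ofReal hint
    (hmem.mono fun h hh => Finset.sum_nonneg fun t _ => (hh t).1)]
  refine lintegral_congr_ae (hmem.mono fun h hh => ?_)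
  exact ENNReal.ofReal_sum_of_nonneg fun t _ => (hh t).1

lemma expectedReward_nonneg (A : Algorithm K) (I : Instance K) (B : ℝ) :
    0 ≤ A.expectedReward I B :=
  integral_nonneg_of_ae ((ae_outcomeReward_mem A.toPolicy I B ⌊B⌋₊).mono fun _ hh =>
    Finset.sum_nonneg fun t _ => (hh t).1)

/-- If in every round the conditional expectation of reward plus penalty `d` is at most `M`, then the
expected total reward plus the expected total penalty is at most `⌊B⌋ * M`. -/
lemma expectedReward_add_le (A : Algorithm K) (I : Instance K) (B M : ℝ)
    {d : Outcome K → ℝ≥0∞} (hd : Measurable d)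
    (h : ∀ a, ∫⁻ o, ENNReal.ofReal (outcomeReward o) + d o ∂I.respond a ≤ ENNReal.ofReal M) :
    ENNReal.ofReal (A.expectedReward I B) + ∫⁻ h, ∑ t, d (h t) ∂A.law I B ⌊B⌋₊ ≤
      ENNReal.ofReal (⌊B⌋₊ * M) := by
  have hr := measurable_outcomeReward (K := K).ennreal_ofReal
  rw [ofReal_expectedReward, ← lintegral_add_left (measurable_sum_apply hr)]
  simp_rw [← Finset.sum_add_distrib]
  refine (lintegral_sum_le_of_respond A.toPolicy I B _ (hr.add hd)
    (measurable_const (a := ENNReal.ofReal M)) fun a => ?_).trans ?_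
  · simpa using h a
  · rw [ENNReal.ofReal_mul (by positivity)]
    simp

lemma lintegral_ofReal_reward_le_one (I : Instance K) (a : Action K) :
    ∫⁻ o, ENNReal.ofReal (outcomeReward o) ∂I.respond a ≤ 1 := by
  have hr := measurable_outcomeReward (K := K).ennreal_ofReal
  rcases a with i | u
  · rw [lintegral_respond_inl I i hr]
    refine (lintegral_mono_ae (g := 1) ((I.reward_mem i).mono fun x hx => ?_)).trans (by simp)
    simpa [outcomeReward] using hx.2
  · rw [lintegral_respond_inr I u hr]
    simp [outcomeReward]

lemma expectedReward_le (A : Algorithm K) (I : Instance K) (B : ℝ) :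
    A.expectedReward I B ≤ ⌊B⌋₊ := by
  have := expectedReward_add_le A I B 1 (measurable_const (a := 0)) fun a => by
    simpa using lintegral_ofReal_reward_le_one I a
  simpa using (ENNReal.ofReal_le_ofReal_iff (by positivity)).1 (le_of_add_le_left this)

/-- The real-valued supremum is meaningful because `⌊B⌋₊` bounds every expected reward. -/
lemma expectedReward_le_optimalReward (A : Algorithm K) (I : Instance K) (B : ℝ) :
    A.expectedReward I B ≤ I.optimalReward B :=
  le_ciSup (f := fun A : Algorithm K => A.expectedReward I B)
    ⟨⌊B⌋₊, by rintro _ ⟨A, rfl⟩; exact expectedReward_le A I B⟩ A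

lemma regret_nonneg (A : Algorithm K) (I : Instance K) (B : ℝ) : 0 ≤ A.regret I B :=
  sub_nonneg.2 (expectedReward_le_optimalReward A I B)

/-! ### Change of measure -/

instance : MeasurableSingletonClass (Action K) where
  measurableSet_singleton a := by
    rcases a with i | u
    · simpa using (measurableSet_singleton i).inl_image (β := Unit)
    · simpa using (measurableSet_singleton u).inr_image (α := Fin K)

/-- Change of measure: if `I'` differs from `I` only in arm `j` and the reward distribution of `j`
in `I'` is at least `ρ` times that in `I`, then the likelihood ratio of the histories is at least
`ρ ^ N` where `N` is the number of pulls of arm `j`. -/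
lemma lintegral_pow_numPulls_mul_le (A : Policy K) {I I' : Instance K} (hc : I.cost = I'.cost)
    {j : Fin K} (hne : ∀ i, i ≠ j → I.reward i = I'.reward i) {ρ : ℝ≥0∞}
    (hρ : ρ • I.reward j ≤ I'.reward j) (B : ℝ) (n : ℕ) {f : History K n → ℝ≥0∞}
    (hf : Measurable f) :
    ∫⁻ h, ρ ^ numPulls j h * f h ∂A.law I B n ≤ ∫⁻ h, f h ∂A.law I' B n := by
  have hpow : ∀ n, Measurable fun h : History K n => ρ ^ numPulls j h := fun n =>
    (measurable_of_countable (fun k : ℕ => ρ ^ k)).comp (measurable_numPulls j)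
  have hpow' : Measurable fun o : Outcome K => ρ ^ outcomePulls j o :=
    (measurable_of_countable (fun k : ℕ => ρ ^ k)).comp (measurable_outcomePulls j)
  -- One round: only a pull of `j` costs a factor `ρ`; every other response is the same in both
  -- instances.
  have hstep : ∀ (a : Action K) {g : Outcome K → ℝ≥0∞}, Measurable g →
      ∫⁻ o, ρ ^ outcomePulls j o * g o ∂I.respond a ≤ ∫⁻ o, g o ∂I'.respond a := by
    intro a g hg
    rcases a with i | u
    · rw [lintegral_respond_inl I i (hpow'.fun_mul hg), lintegral_respond_inl I' i hg]
      by_cases hi : i = j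
      · subst hi
        simp only [outcomePulls, Sum.elim_inl, if_true, pow_one]
        have hgi : Measurable fun x => g (Sum.inl (i, x)) := hg.comp (measurable_inl_prodMk i)
        rw [lintegral_const_mul _ hgi, ← smul_eq_mul, ← lintegral_smul_measure]
        exact lintegral_mono' hρ le_rfl
      · simp [outcomePulls, hi, hne i hi]
    · rw [lintegral_respond_inr I u (hpow'.fun_mul hg), lintegral_respond_inr I' u hg]
      simp [outcomePulls]
  induction n with
  | zero => simp [Policy.law, numPulls]
  | succ n ih =>
    rw [lintegral_law_succ A I B n ((hpow _).fun_mul hf), lintegral_law_succ A I' B n hf]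
    -- The induction hypothesis is applied to the conditional expectation of `f` under `I'` given
    -- the first `n` rounds. Equal costs mean that the policy acts by the same kernel on both
    -- instances.
    refine le_trans (lintegral_mono fun h => ?_) (ih (measurable_lintegral_snoc A I' B n hf))
    have hm : Measurable fun o => f (Fin.snoc h o) :=
      hf.comp ((measurable_snoc n).comp measurable_prodMk_left)
    rw [← lintegral_const_mul _ (measurable_of_countable _), hc]
    refine lintegral_mono fun a => ?_
    simp_rw [numPulls_snoc, pow_add, mul_assoc]
    rw [lintegral_const_mul _ (hpow'.fun_mul hm)]
    exact mul_le_mul_right (hstep a hm) _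

/-! ### Constant algorithms and the benchmark they give -/

open Classical in
/-- The action of the algorithm that pulls arm `i` as long as it can be afforded. -/
def constantAction (i : Fin K) (c : Fin K → ℝ) (B : ℝ) {n : ℕ} (h : History K n) : Action K :=
  if (∃ t, h t = Sum.inr ()) ∨ B < totalCost c h + c i then Sum.inr () else Sum.inl i

lemma measurable_constantAction (i : Fin K) (c : Fin K → ℝ) (B : ℝ) (n : ℕ) :
    Measurable (constantAction i c B (n := n)) := by
  have hquit : MeasurableSet {h : History K n | ∃ t, h t = Sum.inr ()} := by
    rw [Set.ofPred_exists]
    refine MeasurableSet.iUnion fun t => ?_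
    have hinr : MeasurableSet {o : Outcome K | o = Sum.inr ()} := by
      convert (MeasurableSet.univ (α := Unit)).inr_image (α := Fin K × ℝ) using 1
      ext x
      constructor
      · rintro rfl
        exact ⟨(), trivial, rfl⟩
      · rintro ⟨u, -, rfl⟩
        rfl
    exact (measurable_pi_apply t : Measurable fun h : History K n => h t) hinr
  have hcost : MeasurableSet {h : History K n | B < totalCost c h + c i} :=
    measurableSet_lt measurable_const ((measurable_totalCost c).add_const _)
  exact Measurable.ite (hquit.union hcost) measurable_const measurable_const

/-- The policy that pulls arm `i` as long as it can be afforded. -/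
def constantPolicy (i : Fin K) : Policy K where
  next c B n := Kernel.deterministic (constantAction i c B) (measurable_constantAction i c B n)
  isMarkovKernel_next _ _ _ := inferInstance
  stop_final c B n h hh := by
    rw [Kernel.deterministic_apply, constantAction, if_pos (Or.inl hh)]

lemma ae_constantPolicy_law_succ (i : Fin K) (I : Instance K) (B : ℝ) (n : ℕ)
    {s : Set (History K (n + 1))} (hs : MeasurableSet s)
    (h : ∀ᵐ h ∂(constantPolicy i).law I B n, ∀ᵐ o ∂I.respond (constantAction i I.cost B h),
      (Fin.snoc h o : History K (n + 1)) ∈ s) :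
    ∀ᵐ h ∂(constantPolicy i).law I B (n + 1), h ∈ s := by
  refine ae_law_succ _ _ _ _ hs (h.mono fun h hh => ?_)
  rw [constantPolicy, Kernel.deterministic_apply, ae_dirac_eq]
  exact hh

/-- The algorithm that pulls arm `i` as long as it can be afforded. -/
def constantAlgorithm (i : Fin K) : Algorithm K where
  toPolicy := constantPolicy i
  within_budget I B hB n := by
    have hs : ∀ n, MeasurableSet {h : History K n | totalCost I.cost h ≤ B} := fun n =>
      measurableSet_le (measurable_totalCost _) measurable_const
    induction n with
    | zero =>
      refine ae_of_all _ fun h => ?_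
      simpa [totalCost, numPulls] using hB.le
    | succ n ih =>
      refine ae_constantPolicy_law_succ i I B n (hs _) (ih.mono fun h hh => ?_)
      have hs' : MeasurableSet {o : Outcome K |
          (Fin.snoc h o : History K (n + 1)) ∈ {h | totalCost I.cost h ≤ B}} :=
        (measurable_snoc n).comp measurable_prodMk_left (hs _)
      rw [constantAction]
      split_ifs with hcase
      · exact ae_respond_inr I () hs' ((totalCost_snoc_inr I.cost h ()).trans_le hh)
      · push Not at hcase
        exact ae_respond_inl I i hs' (ae_of_all _ fun x =>
          (totalCost_snoc_inl I.cost h i x).trans_le hcase.2)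

/-- With unit costs the constant algorithm pulls its arm in each of the first `⌊B⌋` rounds. -/
lemma ae_constantAlgorithm_pulls (i : Fin K) (I : Instance K) (hI : ∀ i, I.cost i = 1) {B : ℝ}
    (hB : 0 ≤ B) {n : ℕ} (hn : n ≤ ⌊B⌋₊) :
    ∀ᵐ h ∂(constantAlgorithm i).law I B n, ∀ t, outcomePulls i (h t) = 1 := by
  have hs : ∀ n, MeasurableSet {h : History K n | ∀ t, outcomePulls i (h t) = 1} := fun n => by
    simp only [Set.ofPred_forall]
    exact MeasurableSet.iInter fun t =>
      (measurable_outcomePulls i).comp (measurable_pi_apply t) (measurableSet_singleton 1)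
  induction n with
  | zero => exact ae_of_all _ fun h t => t.elim0
  | succ n ih =>
    refine ae_constantPolicy_law_succ i I B n (hs _) ((ih (by omega)).mono fun h hh => ?_)
    have hs' : MeasurableSet {o : Outcome K |
        (Fin.snoc h o : History K (n + 1)) ∈ {h | ∀ t, outcomePulls i (h t) = 1}} :=
      (measurable_snoc n).comp measurable_prodMk_left (hs _)
    -- All `n` earlier rounds were pulls of `i`, so the cost is exactly `n`, and `n + 1 ≤ ⌊B⌋₊`
    -- leaves room for one more pull.
    have hcost : totalCost I.cost h = n := by
      have hpulls : ∀ t k, outcomePulls k (h t) = if k = i then 1 else 0 := by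
        intro t k
        have := hh t
        revert this
        rcases h t with p | u <;> simp +contextual [outcomePulls, eq_comm]
      simp [totalCost, hI, numPulls_eq, hpulls, Finset.sum_ite_eq']
    have hle : ((n + 1 : ℕ) : ℝ) ≤ B := (Nat.le_floor_iff hB).1 hn
    have hact : constantAction i I.cost B h = Sum.inl i := by
      rw [constantAction, if_neg]
      rintro (⟨t, ht⟩ | hlt)
      · simpa [ht, outcomePulls] using hh t
      · rw [hcost, hI] at hlt
        push_cast at hle
        linarith
    rw [hact]
    refine ae_respond_inl I i hs' (ae_of_all _ fun x t => ?_)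
    refine Fin.lastCases ?_ (fun t => ?_) t
    · simp [outcomePulls]
    · simpa using hh t

/-- The benchmark is `constantAlgorithm i`: crediting `M` for each pull of `i` never exceeds the
expected reward, and almost surely all `⌊B⌋₊` rounds are such pulls. -/
lemma floor_mul_le_optimalReward (i : Fin K) (I : Instance K) (hI : ∀ i, I.cost i = 1) {B : ℝ}
    (hB : 0 ≤ B) {M : ℝ} (hM : ENNReal.ofReal M ≤ ∫⁻ x, ENNReal.ofReal x ∂I.reward i) :
    ⌊B⌋₊ * M ≤ I.optimalReward B := by
  refine le_trans ?_ (expectedReward_le_optimalReward (constantAlgorithm i) I B)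
  rw [← ENNReal.ofReal_le_ofReal_iff (expectedReward_nonneg _ _ _), ofReal_expectedReward]
  have hr := measurable_outcomeReward (K := K).ennreal_ofReal
  have hg : Measurable fun o : Outcome K => ENNReal.ofReal M * (outcomePulls i o : ℝ≥0∞) :=
    (measurable_of_countable fun k : ℕ => ENNReal.ofReal M * k).comp (measurable_outcomePulls i)
  refine le_trans ?_ (lintegral_sum_le_of_respond (constantAlgorithm i).toPolicy I B ⌊B⌋₊ hg hr ?_)
  · rw [lintegral_congr_ae (g := fun _ => ENNReal.ofReal (⌊B⌋₊ * M))]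
    · simp
    · filter_upwards [ae_constantAlgorithm_pulls i I hI hB le_rfl] with h hh
      simp [hh, ENNReal.ofReal_mul]
  · rintro (k | u)
    · rw [lintegral_respond_inl I k hg, lintegral_respond_inl I k hr]
      by_cases hk : k = i
      · subst hk
        simpa [outcomePulls, outcomeReward] using hM
      · simp [outcomePulls, hk]
    · rw [lintegral_respond_inr I u hg]
      simp [outcomePulls]

/-- If `M` is the mean reward of arm `i` and in every round the conditional expectation of reward
plus penalty `d` is at most `M`, then the expected total penalty is a lower bound of the regret. -/
lemma lintegral_penalty_le_regret (A : Algorithm K) (I : Instance K) (hI : ∀ i, I.cost i = 1)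
    {B : ℝ} (hB : 0 ≤ B) (i : Fin K) {M : ℝ}
    (hM : ENNReal.ofReal M ≤ ∫⁻ x, ENNReal.ofReal x ∂I.reward i)
    {d : Outcome K → ℝ≥0∞} (hd : Measurable d)
    (h : ∀ a, ∫⁻ o, ENNReal.ofReal (outcomeReward o) + d o ∂I.respond a ≤ ENNReal.ofReal M) :
    ∫⁻ h, ∑ t, d (h t) ∂A.law I B ⌊B⌋₊ ≤ ENNReal.ofReal (A.regret I B) := by
  rw [Algorithm.regret, ENNReal.ofReal_sub _ (expectedReward_nonneg _ _ _)]
  refine ENNReal.le_sub_of_add_le_left ENNReal.ofReal_ne_top ?_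
  exact (expectedReward_add_le A I B M hd h).trans
    (ENNReal.ofReal_le_ofReal (floor_mul_le_optimalReward i I hI hB hM))

/-! ### Bernoulli instances and regret as a count of pulls -/

/-- The Bernoulli distribution on `{0, 1} ⊆ ℝ` with mean `p`. -/
def bernoulliReward (p : ℝ) : Measure ℝ :=
  ENNReal.ofReal p • Measure.dirac 1 + ENNReal.ofReal (1 - p) • Measure.dirac 0

lemma lintegral_bernoulliReward (p : ℝ) (f : ℝ → ℝ≥0∞) :
    ∫⁻ x, f x ∂bernoulliReward p = ENNReal.ofReal p * f 1 + ENNReal.ofReal (1 - p) * f 0 := by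
  simp [bernoulliReward]

/-- It suffices to compare the masses of the two atoms. -/
lemma smul_bernoulliReward_le {p q r : ℝ} (hr : 0 ≤ r) (h₁ : r * p ≤ q)
    (h₀ : r * (1 - p) ≤ 1 - q) :
    ENNReal.ofReal r • bernoulliReward p ≤ bernoulliReward q := by
  rw [bernoulliReward, bernoulliReward, smul_add, smul_smul, smul_smul, ← ENNReal.ofReal_mul hr,
    ← ENNReal.ofReal_mul hr]
  gcongr

/-- The bandit with unit costs and Bernoulli rewards with means `p`. -/
def bernoulliInstance (p : Fin K → ℝ) (hp : ∀ i, p i ∈ Set.Icc (0 : ℝ) 1) : Instance K where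
  cost _ := 1
  one_le_cost _ := le_rfl
  reward i := bernoulliReward (p i)
  isProbabilityMeasure_reward i := ⟨by
    rw [← lintegral_one, lintegral_bernoulliReward, mul_one, mul_one,
      ← ENNReal.ofReal_add (hp i).1 (sub_nonneg.2 (hp i).2)]
    simp⟩
  reward_mem i := by
    rw [bernoulliReward, ae_add_measure_iff]
    exact ⟨Measure.ae_smul_measure (by simp [ae_dirac_eq]) _,
      Measure.ae_smul_measure (by simp [ae_dirac_eq]) _⟩

/-- Charging a penalty `α` per round and an extra `β` per pull of arm `j`, such that reward plus
penalty never exceeds the mean of arm `i₀` in expectation, gives a lower bound of the regret. -/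
lemma lintegral_numPulls_le_regret (A : Algorithm K) {p : Fin K → ℝ}
    (hp : ∀ i, p i ∈ Set.Icc (0 : ℝ) 1) (i₀ j : Fin K) {α β : ℝ} (hα : 0 ≤ α) (hαβ : 0 ≤ α + β)
    (hquit : α ≤ p i₀) (hj : p j + (α + β) ≤ p i₀) (hne : ∀ i, i ≠ j → p i + α ≤ p i₀) {B : ℝ}
    (hB : 0 ≤ B) :
    ∫⁻ h, ENNReal.ofReal (α * ⌊B⌋₊ + β * numPulls j h) ∂A.law (bernoulliInstance p hp) B ⌊B⌋₊ ≤
      ENNReal.ofReal (A.regret (bernoulliInstance p hp) B) := by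
  let d : Outcome K → ℝ≥0∞ := fun o => ENNReal.ofReal (α + β * outcomePulls j o)
  have hd : Measurable d := (measurable_of_countable fun k : ℕ => ENNReal.ofReal (α + β * k)).comp
    (measurable_outcomePulls j)
  have hmean : ∀ i, ∫⁻ x, ENNReal.ofReal x ∂(bernoulliInstance p hp).reward i =
      ENNReal.ofReal (p i) := fun i => by
    simp [bernoulliInstance, lintegral_bernoulliReward]
  have hsum : ∀ h : History K ⌊B⌋₊,
      ENNReal.ofReal (α * ⌊B⌋₊ + β * numPulls j h) = ∑ t, d (h t) := fun h => by
    rw [← ENNReal.ofReal_sum_of_nonneg, Finset.sum_add_distrib, ← Finset.mul_sum, numPulls_eq]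
    · simp [mul_comm]
    · intro t _
      rcases h t with q | u
      · by_cases hq : q.1 = j <;> simp [outcomePulls, hq, hα, hαβ]
      · simpa [outcomePulls] using hα
  simp_rw [hsum]
  refine lintegral_penalty_le_regret A _ (fun _ => rfl) hB i₀ (hmean i₀).ge hd ?_
  have hr := measurable_outcomeReward (K := K).ennreal_ofReal
  rintro (i | u)
  · rw [lintegral_respond_inl _ i (hr.fun_add hd)]
    have hconst : ∀ x : ℝ, ENNReal.ofReal (outcomeReward (Sum.inl (i, x) : Outcome K)) +
        d (Sum.inl (i, x)) =
          ENNReal.ofReal x + ENNReal.ofReal (α + β * if i = j then 1 else 0) := fun x => by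
      simp [d, outcomeReward, outcomePulls]
    simp_rw [hconst]
    rw [lintegral_add_right _ measurable_const, hmean, lintegral_const, measure_univ, mul_one]
    by_cases hi : i = j
    · subst hi
      rw [if_pos rfl, mul_one, ← ENNReal.ofReal_add (hp _).1 hαβ]
      exact ENNReal.ofReal_le_ofReal hj
    · rw [if_neg hi, mul_zero, add_zero, ← ENNReal.ofReal_add (hp _).1 hα]
      exact ENNReal.ofReal_le_ofReal (hne i hi)
  · rw [lintegral_respond_inr _ u (hr.fun_add hd)]
    simpa [d, outcomeReward, outcomePulls] using ENNReal.ofReal_le_ofReal hquit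

/-- Markov's inequality for the measure of a set on which the function is at least `c`. -/
lemma mul_measureReal_le_of_lintegral_le {Ω : Type*} [MeasurableSpace Ω] {μ : Measure Ω}
    [IsProbabilityMeasure μ] {F : Ω → ℝ≥0∞} (hF : Measurable F) {s : Set Ω} {c R : ℝ}
    (hc : 0 ≤ c) (hR : 0 ≤ R) (hs : ∀ x ∈ s, ENNReal.ofReal c ≤ F x)
    (h : ∫⁻ x, F x ∂μ ≤ ENNReal.ofReal R) : c * μ.real s ≤ R := by
  rw [← ENNReal.ofReal_le_ofReal_iff hR, ENNReal.ofReal_mul hc, ofReal_measureReal]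
  calc ENNReal.ofReal c * μ s ≤ ENNReal.ofReal c * μ {x | ENNReal.ofReal c ≤ F x} := by
        gcongr
        exact hs
    _ ≤ ∫⁻ x, F x ∂μ := mul_meas_ge_le_lintegral hF _
    _ ≤ _ := h

/-! ### Two hard instances and their trade-off -/

/-- Means of the reference instance: arm `i₀` is the best one. -/
def baseMean (i₀ : Fin K) (i : Fin K) : ℝ := if i = i₀ then 1 / 2 else 1 / 4

lemma baseMean_mem (i₀ i : Fin K) : baseMean i₀ i ∈ Set.Icc (0 : ℝ) 1 := by
  rw [baseMean]
  split_ifs <;> norm_num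

/-- Means of the alternative instance, in which arm `j` is improved and becomes the best one. -/
def altMean (i₀ j : Fin K) : Fin K → ℝ := Function.update (baseMean i₀) j (3 / 4)

lemma altMean_mem (i₀ j i : Fin K) : altMean i₀ j i ∈ Set.Icc (0 : ℝ) 1 := by
  by_cases h : i = j
  · subst h
    simp only [altMean, Function.update_self]
    norm_num
  · simpa [altMean, h] using baseMean_mem i₀ i

/-- If arm `j` is pulled rarely on the reference instance, then the regret on the alternative instance
is large; if it is pulled often, then the regret on the reference instance is large. -/
lemma exists_regret_tradeoff (A : Algorithm K) {i₀ j : Fin K} (hij : j ≠ i₀) {B : ℝ} (hB : 0 ≤ B)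
    {m : ℕ} (hm : m ≤ ⌊B⌋₊) :
    ∃ q : ℝ,
      (1 / 3) ^ m * ((⌊B⌋₊ - m) / 4) * q ≤
        A.regret (bernoulliInstance (altMean i₀ j) (altMean_mem i₀ j)) B ∧
      (m + 1) / 4 * (1 - q) ≤ A.regret (bernoulliInstance (baseMean i₀) (baseMean_mem i₀)) B := by
  set I := bernoulliInstance (baseMean i₀) (baseMean_mem i₀) with hI
  set I' := bernoulliInstance (altMean i₀ j) (altMean_mem i₀ j) with hI'
  have hm' : (m : ℝ) ≤ ⌊B⌋₊ := by exact_mod_cast hm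
  have hmeas : ∀ (α β : ℝ), Measurable fun h : History K ⌊B⌋₊ =>
      ENNReal.ofReal (α * ⌊B⌋₊ + β * numPulls j h) := fun α β =>
    (measurable_of_countable fun k : ℕ => ENNReal.ofReal (α * ⌊B⌋₊ + β * k)).comp
      (measurable_numPulls j)
  have hpow : Measurable fun h : History K ⌊B⌋₊ => ENNReal.ofReal (1 / 3) ^ numPulls j h :=
    (measurable_of_countable fun k : ℕ => ENNReal.ofReal (1 / 3) ^ k).comp (measurable_numPulls j)
  have hS : MeasurableSet {h : History K ⌊B⌋₊ | numPulls j h ≤ m} :=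
    measurable_numPulls j (measurableSet_Iic (a := m))
  -- `q` is the probability, on the reference instance, of at most `m` pulls of `j`.
  refine ⟨(A.law I B ⌊B⌋₊).real {h | numPulls j h ≤ m}, ?_, ?_⟩
  · have hchange := lintegral_pow_numPulls_mul_le A.toPolicy (I := I) (I' := I') rfl (j := j)
      (fun i hi => by simp [hI, hI', bernoulliInstance, altMean, hi])
      -- The likelihood ratio of arm `j` is 3 at reward 1 and 1/3 at reward 0.
      (ρ := ENNReal.ofReal (1 / 3))
      (smul_bernoulliReward_le (by norm_num)
        (by simp only [altMean, baseMean, Function.update_self, if_neg hij]; norm_num)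
        (by simp only [altMean, baseMean, Function.update_self, if_neg hij]; norm_num))
      B ⌊B⌋₊ (hmeas (1 / 4) (-(1 / 4)))
    -- In the alternative every round not spent on `j` loses at least 3/4 - 1/2 = 1/4, so the
    -- penalty totals `(⌊B⌋₊ - numPulls j h) / 4`.
    have hreg := lintegral_numPulls_le_regret A (altMean_mem i₀ j) j j (α := 1 / 4) (β := -(1 / 4))
      (by norm_num) (by norm_num) (by simp only [altMean, Function.update_self]; norm_num)
      (by simp) (fun i hi => by
        simp only [altMean, Function.update_self, Function.update_of_ne hi, baseMean]
        split_ifs <;> norm_num) hB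
    refine mul_measureReal_le_of_lintegral_le (hpow.fun_mul (hmeas _ _))
      (mul_nonneg (by positivity) (by linarith)) (regret_nonneg _ _ _) (fun h hh => ?_)
      (hchange.trans hreg)
    rw [ENNReal.ofReal_mul (by positivity), ENNReal.ofReal_pow (by norm_num)]
    refine mul_le_mul' (pow_le_pow_right_of_le_one' ?_ hh) (ENNReal.ofReal_le_ofReal ?_)
    · exact ENNReal.ofReal_le_one.2 (by norm_num)
    · have : (numPulls j h : ℝ) ≤ m := by exact_mod_cast hh
      linarith
  -- On the reference instance each pull of `j` loses 1/2 - 1/4 = 1/4.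
  · have hreg := lintegral_numPulls_le_regret A (baseMean_mem i₀) i₀ j (α := 0) (β := 1 / 4)
      le_rfl (by norm_num) (by simp [baseMean]) (by simp only [baseMean, if_neg hij]; norm_num)
      (fun i hi => by simp only [baseMean]; split_ifs <;> norm_num) hB
    rw [← probReal_compl_eq_one_sub hS]
    refine mul_measureReal_le_of_lintegral_le (hmeas _ _) (by positivity) (regret_nonneg _ _ _)
      (fun h hh => ENNReal.ofReal_le_ofReal ?_) hreg
    have hlt : m + 1 ≤ numPulls j h := by simpa using hh
    have : (m + 1 : ℝ) ≤ numPulls j h := by exact_mod_cast hlt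
    linarith

/-! ### Logarithmic lower bounds -/

/-- A consistent algorithm has at least logarithmic regret on the reference instance. -/
lemma Algorithm.IsConsistent.eventually_log_le_regret {A : Algorithm K} (hA : A.IsConsistent) {i₀ j : Fin K}
    (hij : j ≠ i₀) :
    ∀ᶠ B : ℝ in atTop, 1 / (16 * Real.log 3) * Real.log B ≤
      A.regret (bernoulliInstance (baseMean i₀) (baseMean_mem i₀)) B := by
  have hlog3 : 1 / 2 < Real.log 3 := by
    have := Real.log_two_gt_d9
    have := Real.log_lt_log (by norm_num) (show (2 : ℝ) < 3 by norm_num)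
    linarith
  -- The exponent 1/2 matches `3 ^ m ≤ √B`; the factor 1/16 is the one that `q > 1/2` would violate,
  -- by `h3` and `h4`.
  have hsub := (hA (bernoulliInstance (altMean i₀ j) (altMean_mem i₀ j)) (1 / 2)
    (by norm_num)).bound (show (0 : ℝ) < 1 / 16 by norm_num)
  have hlog := Real.isLittleO_log_id_atTop.bound (show (0 : ℝ) < 1 / 4 by norm_num)
  filter_upwards [hsub, hlog, eventually_ge_atTop 4] with B hreg hlogB hB4
  have hlog0 : 0 ≤ Real.log B := Real.log_nonneg (by linarith)
  rw [Real.norm_of_nonneg (regret_nonneg _ _ _), ← Real.sqrt_eq_rpow,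
    Real.norm_of_nonneg (Real.sqrt_nonneg _)] at hreg
  rw [Real.norm_of_nonneg hlog0, id, Real.norm_of_nonneg (by linarith)] at hlogB
  -- The largest `m` with `3 ^ m ≤ √B`.
  set m := ⌊Real.log B / (2 * Real.log 3)⌋₊ with hm
  have hx : 0 ≤ Real.log B / (2 * Real.log 3) := by positivity
  have hm_le : (m : ℝ) ≤ Real.log B / (2 * Real.log 3) := Nat.floor_le hx
  have hm_lt : Real.log B / (2 * Real.log 3) < m + 1 := Nat.lt_floor_add_one _
  have hm_log : (m : ℝ) * (2 * Real.log 3) ≤ Real.log B := (le_div_iff₀ (by linarith)).1 hm_le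
  have hm_le' : (m : ℝ) ≤ Real.log B :=
    hm_le.trans (div_le_self hlog0 (by linarith))
  have hfloor : B < ⌊B⌋₊ + 1 := Nat.lt_floor_add_one B
  have hm_floor : m ≤ ⌊B⌋₊ := (Nat.le_floor_iff (by linarith)).2 (by linarith)
  obtain ⟨q, hq', hq⟩ := exists_regret_tradeoff A hij (show 0 ≤ B by linarith) hm_floor
  have hs : 0 < √B := Real.sqrt_pos.2 (by linarith)
  have hss : √B * √B = B := Real.mul_self_sqrt (by linarith)
  have hpow : (3 : ℝ) ^ m ≤ √B := by
    rw [← Real.log_le_log_iff (by positivity) hs, Real.log_pow, Real.log_sqrt (by linarith)]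
    linarith
  have hq2 : q ≤ 1 / 2 := by
    by_contra! hlt
    have h1 : 1 / √B ≤ (1 / 3) ^ m := by
      rw [one_div_pow]
      exact one_div_le_one_div_of_le (by positivity) hpow
    -- Since `B ≥ 4`, `⌊B⌋₊ ≥ 3B/4`, while `m ≤ log B ≤ B/4`.
    have h2 : B / 8 ≤ (⌊B⌋₊ - m) / 4 := by linarith
    have h3 : 1 / √B * (B / 8) * (1 / 2) < (1 / 3) ^ m * ((⌊B⌋₊ - m) / 4) * q := by
      have : 0 < 1 / √B * (B / 8) := by positivity
      calc _ < 1 / √B * (B / 8) * q := by gcongr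
        _ ≤ _ := by gcongr
    have h4 : 1 / √B * (B / 8) * (1 / 2) = 1 / 16 * √B := by
      rw [← hss, Real.sqrt_mul_self hs.le]
      field_simp
      norm_num
    linarith
  have hfin : (m + 1 : ℝ) / 4 * (1 / 2) ≤ (m + 1) / 4 * (1 - q) := by
    gcongr
    linarith
  -- The `+ 1` in `m + 1` absorbs the floor, which leaves exactly this constant.
  have hC : 1 / (16 * Real.log 3) * Real.log B = Real.log B / (2 * Real.log 3) / 8 := by
    field_simp
    ring
  linarith

/-- An algorithm that is not consistent has at least logarithmic regret on some instance for
arbitrarily large budgets. -/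
lemma exists_frequently_log_le_regret_of_not_isConsistent {A : Algorithm K}
    (hA : ¬ A.IsConsistent) :
    ∃ C : ℝ, 0 < C ∧ ∃ I : Instance K, ∃ᶠ B : ℝ in atTop, C * Real.log B ≤ A.regret I B := by
  simp only [Algorithm.IsConsistent, isLittleO_iff, not_forall] at hA
  obtain ⟨I, a, ha, c, hc, hfreq⟩ := hA
  refine ⟨1, one_pos, I, ?_⟩
  -- The `c` violated infinitely often by the regret is reused: eventually `log B ≤ c * B ^ a`.
  have hlog := (isLittleO_log_rpow_atTop ha).bound hc
  refine ((not_eventually.1 hfreq).and_eventually hlog).mono fun B hB => ?_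
  obtain ⟨h1, h2⟩ := hB
  rw [not_le, Real.norm_of_nonneg (regret_nonneg _ _ _)] at h1
  rw [one_mul]
  exact (le_abs_self _).trans (h2.trans h1.le)

end BudgetMAB

end

theorem theorem4 (K : ℕ) (hK : 2 ≤ K) (A : BudgetMAB.Algorithm K) :
    (∃ C : ℝ, 0 < C ∧ ∃ I : BudgetMAB.Instance K,
      ∃ᶠ B : ℝ in atTop, C * Real.log B ≤ A.regret I B) ∧
    (A.IsConsistent →
      ∃ C : ℝ, 0 < C ∧ ∃ I : BudgetMAB.Instance K,
        ∀ᶠ B : ℝ in atTop, C * Real.log B ≤ A.regret I B) := by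
  have hlog3 : 0 < 1 / (16 * Real.log 3) := by
    have := Real.log_pos (show (1 : ℝ) < 3 by norm_num)
    positivity
  have hij : (⟨1, by omega⟩ : Fin K) ≠ ⟨0, by omega⟩ := by simp
  refine ⟨?_, fun hA => ⟨_, hlog3, _, hA.eventually_log_le_regret hij⟩⟩
  by_cases hA : A.IsConsistent
  · exact ⟨_, hlog3, _, (hA.eventually_log_le_regret hij).frequently⟩
  · exact BudgetMAB.exists_frequently_log_le_regret_of_not_isConsistent hA
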